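/- Let $\mathrm{ProFin}$ be the category of profinite sets and $\mathrm{Cond}$ the category of condensed sets, i.e. of those sheaves of sets on $\mathrm{ProFin}$, for the topology of finite jointly surjective families, whose underlying presheaf is accessible (left Kan extended from the $\kappa$-small profinite sets for some cardinal $\kappa$). Regard $\mathrm{ProFin}$ as a full subcategory of $\mathrm{Cond}$ by $S\mapsto \mathrm{Hom}(-,S)$. For a field $k$, let $\mathrm{Shv}_k^{\mathrm{fpqc}}$ be the category of fpqc sheaves of sets on the opposite of the category of commutative $k$-algebras. For a profinite set $S$ let $\mathcal C(S,k)$ be the $k$-algebra of continuous functions from $S$ to the discrete set $k$. The pétra space $X_k^{\mathrm{p\acute et}}\in \mathrm{Shv}_k^{\mathrm{fpqc}}$ of a condensed set $X$ is the inverse image of $X$ along $S\mapsto \mathcal C(S,k)$: the fpqc sheafification of the left Kan extension of $X$ along this functor, so that morphisms $X_k^{\mathrm{p\acute et}}\to\mathcal Y$ correspond naturally to morphisms from $X$ to $S\mapsto \mathcal Y(\mathcal C(S,k))$. For an fpqc sheaf $\mathcal X$ let $\Gamma(\mathcal X;\mathcal O)$ be the $k$-algebra of morphisms from $\mathcal X$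 to the affine line $A\mapsto A$. The affinization of $\mathcal X$ is $\mathrm{Aff}(\mathcal X)=\mathrm{Spec}\,\Gamma(\mathcal X;\mathcal O)$, i.e. $A\mapsto \mathrm{Hom}_{k\text{-alg}}(\Gamma(\mathcal X;\mathcal O),A)$, with its canonical map $\mathcal X\to\mathrm{Aff}(\mathcal X)$ given by evaluation. 1. The inclusion $\mathrm{ProFin}\to\mathrm{Cond}$ admits a left adjoint $\widehat\pi_0:\mathrm{Cond}\to\mathrm{ProFin}$. 2. For every finite field $k$ and every condensed set $X$ there is a homeomorphism $$\widehat\pi_0(X)\;\simeq\;\left|\mathrm{Spec}\,\mathrm{Hom}_{\mathrm{Cond}}(X,k)\right|,$$ natural in $X$, where $k$ is regarded as a discrete (finite) profinite set and $\mathrm{Hom}_{\mathrm{Cond}}(X,k)$ carries the pointwise ring structure. It sends a point $p$ to the prime ideal of those $\varphi:X\to k$ whose corresponding continuous map $\widehat\pi_0(X)\to k$ vanishes at $p$. 3. For every finite field $k$ and every condensed set $X$, the affinization of the pétra space of $X$ is the pétra space of the profinite set $\widehat\pi_0(X)$: there is an isomorphism $$\mathrm{Aff}\big(X_k^{\mathrm{p\acute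 et}}\big)\;\simeq\;\widehat\pi_0(X)_k^{\mathrm{p\acute et}},$$ natural in $X$, under which the canonical map $X_k^{\mathrm{p\acute et}}\to\mathrm{Aff}(X_k^{\mathrm{p\acute et}})$ corresponds to the map $X_k^{\mathrm{p\acute et}}\to\widehat\pi_0(X)_k^{\mathrm{p\acute et}}$ induced by the unit $X\to\widehat\pi_0(X)$ of the adjunction. -/

import Mathlib

open CategoryTheory Opposite

universe u

noncomputable section

namespace Petra

/-! ### Condensed sets -/

/-- The profinite sets with fewer than `κ` points. -/
def smallProfinite (κ : Cardinal.{u}) : ObjectProperty Profinite.{u} :=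
  fun S => Cardinal.mk S < κ

/-- A presheaf of (small) sets on profinite sets is accessible if, for some cardinal `κ`, it is the
left Kan extension of its restriction to the `κ`-small profinite sets. If this holds for `κ` then
it holds for every larger cardinal, so `κ` may be taken as inaccessible as one likes. -/
def IsAccessible (F : Profinite.{u}ᵒᵖ ⥤ Type u) : Prop :=
  ∃ κ : Cardinal.{u}, F.IsLeftKanExtension (𝟙 ((smallProfinite κ).ι.op ⋙ F))

/-- The category of condensed sets: sheaves of (small) sets on profinite sets, for the topology of
finite jointly surjective families, whose underlying presheaf is accessible. -/
abbrev Cond : Type (u + 1) :=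
  ObjectProperty.FullSubcategory
    (fun X : Sheaf (coherentTopology Profinite.{u}) (Type u) => IsAccessible X.obj)

/-- The value `X(S)` of a condensed set on a profinite set. -/
abbrev Cond.val (X : Cond.{u}) (S : Profinite.{u}) : Type u := X.obj.obj.obj (op S)

/-- Restriction `X(T) → X(S)` along `g : S ⟶ T`. -/
abbrev Cond.res (X : Cond.{u}) {S T : Profinite.{u}} (g : S ⟶ T) (x : X.val T) : X.val S :=
  X.obj.obj.map g.op x

/-- The map `X(S) → Y(S)` given by a morphism of condensed sets. -/
abbrev Cond.app {X Y : Cond.{u}} (f : X ⟶ Y) (S : Profinite.{u}) (x : X.val S) : Y.val S :=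
  f.hom.hom.app (op S) x

theorem isAccessible_yoneda (S : Profinite.{u}) : IsAccessible (yoneda.obj S) := by
  refine ⟨Order.succ (Cardinal.mk S), ⟨⟨?_⟩⟩⟩
  let S' : (smallProfinite (Order.succ (Cardinal.mk S))).FullSubcategory :=
    ⟨S, Order.lt_succ _⟩
  refine Limits.IsInitial.ofUniqueHom
    (fun Y => StructuredArrow.homMk (yonedaEquiv.symm (Y.hom.app (op S') (𝟙 S))) ?_) ?_
  · ext T t
    have h := NatTrans.naturality_apply Y.hom
      (ObjectProperty.homMk (X := T.unop) (Y := S') t).op (𝟙 S)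
    simp at h
    simp [yonedaEquiv]
    exact h.symm
  · intro Y m
    ext1
    apply yonedaEquiv.injective
    have h2 := ConcreteCategory.congr_hom (NatTrans.congr_app (StructuredArrow.w m) (op S')) (𝟙 S)
    exact Eq.trans h2 (yonedaEquiv.apply_symm_apply _).symm

/-- The inclusion of profinite sets into condensed sets, `S ↦ Hom(-, S)`. -/
def profiniteToCond : Profinite.{u} ⥤ Cond.{u} :=
  ObjectProperty.lift _ (coherentTopology Profinite.{u}).yoneda isAccessible_yoneda

/-! ### The ring of maps from a condensed set to a finite field -/

section Functions

variable (k : Type u) [Field k] [Finite k]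

/-- The finite field `k` with the discrete topology, as a profinite set. -/
def discreteProfinite : Profinite.{u} :=
  letI : TopologicalSpace k := ⊥
  haveI : DiscreteTopology k := ⟨rfl⟩
  Profinite.of k

/-- The elements of `k` viewed as points of `discreteProfinite k`, and conversely. -/
def discreteProfiniteEquiv : discreteProfinite k ≃ k := Equiv.refl k

/-- Continuous maps from a profinite set to the discrete set `k` are the locally constant ones. -/
def homDiscreteEquiv (S : Profinite.{u}) :
    (S ⟶ discreteProfinite k) ≃ LocallyConstant S k where
  toFun g :=
    letI : TopologicalSpace k := ⊥
    haveI : DiscreteTopology k := ⟨rfl⟩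
    ⟨fun s => discreteProfiniteEquiv k (g s),
      have hg : Continuous (Y := k) (fun s => g s) := g.hom.hom.continuous
      (IsLocallyConstant.iff_continuous (Y := k) _).2 hg⟩
  invFun f :=
    letI : TopologicalSpace k := ⊥
    haveI : DiscreteTopology k := ⟨rfl⟩
    CompHausLike.ofHom (Y := Profinite.of k) _ ⟨fun s => f s, f.continuous⟩
  left_inv _ := rfl
  right_inv _ := rfl

/-- `Hom_Cond(X, k)`: morphisms from `X` to the discrete condensed set `k`. -/
def CondHom (X : Cond.{u}) : Type (u + 1) :=
  X ⟶ profiniteToCond.obj (discreteProfinite k)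

/-- The ring of families of functions `X(S) → C(S, k)` that are natural in `S`, with pointwise
operations. -/
def naturalFunctions (X : Cond.{u}) :
    Subring (∀ S : Profinite.{u}, X.val S → LocallyConstant S k) where
  carrier := {F | ∀ (S T : Profinite.{u}) (g : S ⟶ T) (x : X.val T),
    F S (X.res g x) = (F T x).comap g.hom.hom}
  mul_mem' hF hG S T g x := by ext; simp [hF S T g x, hG S T g x]
  one_mem' S T g x := by ext; simp
  add_mem' hF hG S T g x := by ext; simp [hF S T g x, hG S T g x]
  zero_mem' S T g x := by ext; simp
  neg_mem' hF S T g x := by ext; simp [hF S T g x]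

/-- By definition of `k` as a condensed set, a morphism `X ⟶ k` is a natural family of functions
`X(S) → C(S, k)`. -/
def condHomEquiv (X : Cond.{u}) : CondHom k X ≃ naturalFunctions k X where
  toFun φ := ⟨fun S x => homDiscreteEquiv k S (Cond.app φ S x), fun S T g x =>
    congrArg (homDiscreteEquiv k S) (NatTrans.naturality_apply φ.hom.hom g.op x)⟩
  invFun F := ⟨⟨{
    app := fun S => ↾fun x => (homDiscreteEquiv k S.unop).symm (F.1 S.unop x)
    naturality := fun S T g => by
      ext x
      exact congrArg (homDiscreteEquiv k T.unop).symm (F.2 T.unop S.unop g.unop x) }⟩⟩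
  left_inv _ := rfl
  right_inv _ := rfl

/-- The ring structure of `Hom_Cond(X, k)`: pointwise addition and multiplication in `k`. -/
instance (X : Cond.{u}) : CommRing (CondHom k X) := (condHomEquiv k X).commRing

/-- Precomposition with a morphism of condensed sets, a ring homomorphism
`Hom_Cond(Y, k) → Hom_Cond(X, k)`. -/
def CondHom.pullback {X Y : Cond.{u}} (f : X ⟶ Y) : CondHom k Y →+* CondHom k X where
  toFun φ := (f ≫ φ : X ⟶ _)
  map_one' := rfl
  map_mul' _ _ := rfl
  map_zero' := rfl
  map_add' _ _ := rfl

end Functions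

/-! ### Fpqc sheaves, pétra spaces and affinization -/

section Fpqc

variable (k : Type u) [Field k]

/-- The basic fpqc covers of affine `k`-schemes: finite jointly surjective families of flat maps
`Spec (B i) ⟶ Spec A`. -/
def fpqcPrecoverage : Precoverage (CommAlgCat.{u} k)ᵒᵖ where
  coverings A := {R | ∃ (n : ℕ) (B : Fin n → CommAlgCat.{u} k) (f : ∀ i, A.unop ⟶ B i),
    R = Presieve.ofArrows (fun i => op (B i)) (fun i => (f i).op) ∧
    (∀ i, (f i).hom.toRingHom.Flat) ∧
    ∀ p : PrimeSpectrum A.unop, ∃ i, p ∈ Set.range (PrimeSpectrum.comap (f i).hom.toRingHom)}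

/-- The fpqc topology on the opposite of the category of `k`-algebras. -/
abbrev fpqcTopology : GrothendieckTopology (CommAlgCat.{u} k)ᵒᵖ :=
  (fpqcPrecoverage k).toGrothendieck

/-- Fpqc sheaves over `k`. The values may lie one universe higher than the `k`-algebras, so that
every presheaf on this large site has a sheafification; small fpqc sheaves embed fully faithfully. -/
abbrev FpqcSheaf : Type (u + 2) := Sheaf (fpqcTopology k) (Type (u + 1))

/-- The functor `S ↦ C(S, k)` (for `k` discrete) from profinite sets to the opposite of the
category of `k`-algebras. -/
def continuousFunctions : Profinite.{u} ⥤ (CommAlgCat.{u} k)ᵒᵖ where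
  obj S := op (CommAlgCat.of k (LocallyConstant S k))
  map g := (CommAlgCat.ofHom (LocallyConstant.comapₐ k g.hom.hom)).op

/-- The presheaf underlying a condensed set. -/
def condToPresheaf : Cond.{u} ⥤ Profinite.{u}ᵒᵖ ⥤ Type (u + 1) :=
  ObjectProperty.ι _ ⋙ sheafToPresheaf _ _ ⋙
    (Functor.whiskeringRight _ _ _).obj uliftFunctor.{u + 1, u}

/-- The pétra space functor `X ↦ f^* X`: the inverse image along `S ↦ C(S, k)`, that is, the fpqc
sheafification of the left Kan extension of `X` along `S ↦ C(S, k)`. -/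
def petra : Cond.{u} ⥤ FpqcSheaf k :=
  condToPresheaf ⋙ (continuousFunctions k).op.lan ⋙ presheafToSheaf (fpqcTopology k) (Type (u + 1))

/-- The pétra space functor is left adjoint to enhanced `k`-points: morphisms `f^* X ⟶ 𝒴` are the
morphisms from `X` to `f_* 𝒴 = (S ↦ 𝒴(C(S, k)))`. -/
def petraHomEquiv (X : Cond.{u}) (Y : FpqcSheaf k) :
    ((petra k).obj X ⟶ Y) ≃ (condToPresheaf.obj X ⟶ (continuousFunctions k).op ⋙ Y.obj) :=
  ((sheafificationAdjunction (fpqcTopology k) (Type (u + 1))).homEquiv _ _).trans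
    (((continuousFunctions k).op.lanAdjunction (Type (u + 1))).homEquiv _ _)

/-- The algebra of global functions `Γ(F; 𝒪)`: maps from `F` to the affine line, that is, families
of functions `F(A) → A` natural in the `k`-algebra `A`, with pointwise operations. -/
def globalFunctions (F : (CommAlgCat.{u} k)ᵒᵖᵒᵖ ⥤ Type (u + 1)) :
    Subalgebra k (∀ A : CommAlgCat.{u} k, F.obj (op (op A)) → A) where
  carrier := {a | ∀ (A B : CommAlgCat.{u} k) (f : A ⟶ B) (x : F.obj (op (op A))),
    a B (F.map f.op.op x) = f (a A x)}
  mul_mem' ha hb A B f x := by simp [ha A B f x, hb A B f x]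
  add_mem' ha hb A B f x := by simp [ha A B f x, hb A B f x]
  algebraMap_mem' r A B f x := by simp

variable {k} in
/-- Pullback of global functions along a map of presheaves. -/
def globalFunctions.pullback {F G : (CommAlgCat.{u} k)ᵒᵖᵒᵖ ⥤ Type (u + 1)} (η : F ⟶ G) :
    globalFunctions k G →ₐ[k] globalFunctions k F where
  toFun a := ⟨fun A x => a.1 A (η.app (op (op A)) x), fun A B f x =>
    (congrArg (a.1 B) (NatTrans.naturality_apply η f.op.op x)).trans (a.2 A B f _)⟩
  map_one' := rfl
  map_mul' _ _ := rfl
  map_zero' := rfl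
  map_add' _ _ := rfl
  commutes' _ := rfl

/-- The affinization `Spec Γ(F; 𝒪)` as a functor of points, `A ↦ Hom_k(Γ(F; 𝒪), A)`. -/
def affinizationPresheaf :
    ((CommAlgCat.{u} k)ᵒᵖᵒᵖ ⥤ Type (u + 1)) ⥤ ((CommAlgCat.{u} k)ᵒᵖᵒᵖ ⥤ Type (u + 1)) where
  obj F :=
    { obj := fun A => globalFunctions k F →ₐ[k] A.unop.unop
      map := fun f => ↾fun x => f.unop.unop.hom.comp x }
  map η := { app := fun _ => ↾fun x => x.comp (globalFunctions.pullback η) }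

/-- The affinization functor on fpqc sheaves, `Aff(𝒳) = Spec Γ(𝒳; 𝒪)`. -/
def affinization : FpqcSheaf k ⥤ ((CommAlgCat.{u} k)ᵒᵖᵒᵖ ⥤ Type (u + 1)) :=
  sheafToPresheaf _ _ ⋙ affinizationPresheaf k

/-- The canonical map `𝒳 → Aff(𝒳)`: a point `x ∈ 𝒳(A)` is sent to evaluation of global functions
at `x`. -/
def toAffinization : sheafToPresheaf (fpqcTopology k) (Type (u + 1)) ⟶ affinization k where
  app X :=
    { app := fun A => ↾fun x =>
        { toFun := fun a => a.1 A.unop.unop x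
          map_one' := rfl
          map_mul' := fun _ _ => rfl
          map_zero' := rfl
          map_add' := fun _ _ => rfl
          commutes' := fun _ => rfl }
      naturality := fun A B f => by
        ext x
        exact AlgHom.ext fun a => a.2 _ _ f.unop.unop x }

end Fpqc

end Petra

end

open Petra

noncomputable section

namespace Petra

/-! ### Flat descent along finite jointly surjective families -/

section Descent

open TensorProduct

variable {A : Type*} [CommRing A] {ι : Type*} [Fintype ι] (B : ι → Type*) [∀ i, CommRing (B i)]
  [∀ i, Algebra A (B i)]

/-! A morphism from a condensed set `X` to a profinite set `S` is determined by its values on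
points, so it is a continuous map to `S` from `X(pt)` with the final topology for all evaluation
maps. The Stone–Čech compactification followed by the space of connected components therefore gives
the left adjoint.

A finite field `k` is itself profinite, so the adjunction identifies `Hom(X, k)` with the ring of
locally constant functions on the reflection. For profinite `S` the primes of that ring are the
points of `S` (`vanishingPrime_bijective`), because every function has a pointwise quasi-inverse.

For affinization, `Γ` of the pétra space of `X` is `Hom(X, k)`, since the affine line is an fpqc
sheaf with value `C(S, k)` on `C(S, k)`. Hence the unit of the adjunction induces an isomorphism on
`Γ` (`bijective_pullback_petra_unit`), and so on `Aff`. The pétra space of a profinite `S` is `Spec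
C(S, k)`, as both corepresent `𝒴 ↦ 𝒴(C(S, k))`, and an affine scheme is its own affinization.
Faithfully flat descent enters through subcanonicity, which makes the affine line and the `Spec C(S,
k)` sheaves. -/

theorem faithfullyFlat_pi [∀ i, Module.Flat A (B i)]
    (hB : ∀ p : PrimeSpectrum A, ∃ i, p ∈ Set.range (PrimeSpectrum.comap (algebraMap A (B i)))) :
    Module.FaithfullyFlat A (∀ i, B i) := by
  classical
  have : Module.Flat A (∀ i, B i) :=
    Module.Flat.of_linearEquiv (DirectSum.linearEquivFunOnFintype A ι B).symm
  refine Module.FaithfullyFlat.of_comap_surjective fun p => ?_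
  obtain ⟨i, q, hq⟩ := hB p
  exact ⟨PrimeSpectrum.comap (Pi.evalRingHom B i) q, hq⟩

-- The tensor square of the finite product splits into the blocks `B i ⊗ B j`, so the cocycle
-- condition can be checked block by block.
variable {B} in
theorem tmul_one_eq_one_tmul_pi {x : ∀ i, B i}
    (hx : ∀ i j, x i ⊗ₜ[A] (1 : B j) = (1 : B i) ⊗ₜ[A] x j) :
    x ⊗ₜ[A] (1 : ∀ i, B i) = (1 : ∀ i, B i) ⊗ₜ[A] x := by
  classical
  have key (y z : ∀ i, B i) : y ⊗ₜ[A] z = ∑ i, ∑ j,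
      TensorProduct.map (LinearMap.single A B i) (LinearMap.single A B j) (y i ⊗ₜ[A] z j) := by
    simp only [TensorProduct.map_tmul, LinearMap.single_apply, ← TensorProduct.tmul_sum,
      ← TensorProduct.sum_tmul, Finset.univ_sum_single]
  rw [key x 1, key 1 x]
  exact Finset.sum_congr rfl fun i _ => Finset.sum_congr rfl fun j _ =>
    congrArg _ (hx i j)

theorem eq_of_algebraMap_eq [∀ i, Module.Flat A (B i)]
    (hB : ∀ p : PrimeSpectrum A, ∃ i, p ∈ Set.range (PrimeSpectrum.comap (algebraMap A (B i))))
    {a b : A} (h : ∀ i, algebraMap A (B i) a = algebraMap A (B i) b) : a = b := by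
  have := faithfullyFlat_pi B hB
  exact FaithfulSMul.algebraMap_injective A (∀ i, B i) (funext h)

/-- Exactness of `A → B → B ⊗ B` for the single faithfully flat algebra `B = ∏ B i`. -/
theorem exists_algebraMap_eq [∀ i, Module.Flat A (B i)]
    (hB : ∀ p : PrimeSpectrum A, ∃ i, p ∈ Set.range (PrimeSpectrum.comap (algebraMap A (B i))))
    {x : ∀ i, B i} (hx : ∀ i j, x i ⊗ₜ[A] (1 : B j) = (1 : B i) ⊗ₜ[A] x j) :
    ∃ a : A, ∀ i, algebraMap A (B i) a = x i := by
  have := faithfullyFlat_pi B hB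
  obtain ⟨a, ha⟩ := (Algebra.IsEffective.of_faithfullyFlat A (∀ i, B i) x).1
    (sub_eq_zero.2 (tmul_one_eq_one_tmul_pi hx))
  exact ⟨a, fun i => congrFun ha i⟩

theorem mem_range_comap_baseChange [∀ i, Module.Flat A (B i)] (A' : Type*) [CommRing A'] [Algebra A A']
    (hB : ∀ p : PrimeSpectrum A, ∃ i, p ∈ Set.range (PrimeSpectrum.comap (algebraMap A (B i))))
    (p : PrimeSpectrum A') :
    ∃ i, p ∈ Set.range (PrimeSpectrum.comap (algebraMap A' (A' ⊗[A] B i))) := by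
  classical
  have := faithfullyFlat_pi B hB
  -- Base change commutes with the finite product, so `∏ (A' ⊗ B i)` is faithfully flat over `A'`;
  -- the spectrum of a finite product is the union of those of its factors.
  let e := Algebra.TensorProduct.piRight A A' A' B
  have he : Function.Surjective (PrimeSpectrum.comap (algebraMap A' (∀ i, A' ⊗[A] B i))) := by
    have := Module.FaithfullyFlat.of_linearEquiv A' (A' ⊗[A] ∀ i, B i) e.symm.toLinearEquiv
    exact PrimeSpectrum.comap_surjective_of_faithfullyFlat
  have h := PrimeSpectrum.iUnion_range_comap_comp_evalRingHom (algebraMap A' (∀ i, A' ⊗[A] B i))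
  rw [he.range_eq] at h
  obtain ⟨i, hi⟩ := Set.mem_iUnion.1 (h.ge (Set.mem_univ p))
  exact ⟨i, hi⟩

end Descent

/-! ### The fpqc topology is subcanonical -/

section Subcanonical

variable {k : Type u} [Field k]

open TensorProduct

theorem isSheafFor_yoneda_of_mem_fpqcPrecoverage (C A : (CommAlgCat.{u} k)ᵒᵖ) {R : Presieve A}
    (hR : R ∈ fpqcPrecoverage k A) : R.IsSheafFor (yoneda.obj C) := by
  obtain ⟨n, B, f, rfl, hflat, hsurj⟩ := hR
  let (i : Fin n) : Algebra A.unop (B i) := (f i).hom.toRingHom.toAlgebra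
  have (i : Fin n) : Module.Flat A.unop (B i) := hflat i
  have (i : Fin n) : IsScalarTower k A.unop (B i) :=
    .of_algebraMap_eq fun r => ((f i).hom.commutes r).symm
  rw [Presieve.isSheafFor_arrows_iff]
  intro x hx
  have hx' (c : C.unop) : ∃ a : A.unop, ∀ i, algebraMap A.unop (B i) a = (x i).unop.hom c := by
    refine exists_algebraMap_eq (fun i => B i) hsurj fun i j => ?_
    -- Compatibility is tested on the fibre product of the two covering maps, which is `Spec (B i ⊗
    -- B j)`.
    let l : B i ⟶ CommAlgCat.of k (B i ⊗[A.unop] B j) :=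
      CommAlgCat.ofHom ((Algebra.TensorProduct.includeLeft (R := A.unop) (S := A.unop)
        (A := B i) (B := B j)).restrictScalars k)
    let r : B j ⟶ CommAlgCat.of k (B i ⊗[A.unop] B j) :=
      CommAlgCat.ofHom ((Algebra.TensorProduct.includeRight (R := A.unop)
        (A := B i) (B := B j)).restrictScalars k)
    have h := hx i j (op (CommAlgCat.of k (B i ⊗[A.unop] B j))) l.op r.op (by
      rw [← op_comp, ← op_comp]
      congr 1
      ext a
      exact (Algebra.TensorProduct.algebraMap_apply' (A := B i) (B := B j) a :))
    exact congr($(h).unop.hom c)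
  choose y hy using hx'
  have hinj {a b : A.unop} (h : ∀ i, algebraMap A.unop (B i) a = algebraMap A.unop (B i) b) :
      a = b := eq_of_algebraMap_eq (fun i => B i) hsurj h
  -- The elementwise gluings form an algebra map because each identity can be checked in every `B
  -- i`.
  refine ⟨(CommAlgCat.ofHom (X := C.unop) (Y := A.unop)
    { toFun := y
      map_one' := hinj fun i => by simp [hy]
      map_mul' := fun a b => hinj fun i => by simp [hy]
      map_zero' := hinj fun i => by simp [hy]
      map_add' := fun a b => hinj fun i => by simp [hy]
      commutes' := fun r => hinj fun i => by
        rw [hy, AlgHom.commutes, ← IsScalarTower.algebraMap_apply] }).op, fun i => ?_, ?_⟩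
  · apply Quiver.Hom.unop_inj
    ext c
    exact hy c i
  · intro z hz
    apply Quiver.Hom.unop_inj
    ext c
    refine hinj fun i => ?_
    exact congr($(hz i).unop.hom c).trans (hy c i).symm

theorem fpqcPrecoverage_pullback {X Y : (CommAlgCat.{u} k)ᵒᵖ} (f : Y ⟶ X) (S : Presieve X)
    (hS : S ∈ fpqcPrecoverage k X) :
    ∃ T ∈ fpqcPrecoverage k Y, T.FactorsThruAlong S f := by
  obtain ⟨n, B, g, rfl, hflat, hsurj⟩ := hS
  let (i : Fin n) : Algebra X.unop (B i) := (g i).hom.toRingHom.toAlgebra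
  let : Algebra X.unop Y.unop := f.unop.hom.toRingHom.toAlgebra
  have (i : Fin n) : Module.Flat X.unop (B i) := hflat i
  have (i : Fin n) : IsScalarTower k X.unop (B i) :=
    .of_algebraMap_eq fun r => ((g i).hom.commutes r).symm
  have : IsScalarTower k X.unop Y.unop :=
    .of_algebraMap_eq fun r => (f.unop.hom.commutes r).symm
  let l (i : Fin n) : Y.unop ⟶ CommAlgCat.of k (Y.unop ⊗[X.unop] B i) :=
    CommAlgCat.ofHom ((Algebra.TensorProduct.includeLeft (R := X.unop) (S := X.unop)
      (A := Y.unop) (B := B i)).restrictScalars k)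
  let r (i : Fin n) : B i ⟶ CommAlgCat.of k (Y.unop ⊗[X.unop] B i) :=
    CommAlgCat.ofHom ((Algebra.TensorProduct.includeRight (R := X.unop)
      (A := Y.unop) (B := B i)).restrictScalars k)
  have h (i : Fin n) : f.unop ≫ l i = g i ≫ r i := by
    ext a
    exact Algebra.TensorProduct.tmul_one_eq_one_tmul (R := X.unop) (A := Y.unop) (B := B i) a
  refine ⟨_, ⟨n, fun i => CommAlgCat.of k (Y.unop ⊗[X.unop] B i), l, rfl, fun i => ?_,
    mem_range_comap_baseChange (fun i => B i) Y.unop hsurj⟩, ?_⟩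
  · exact (RingHom.flat_algebraMap_iff (R := Y.unop) (S := Y.unop ⊗[X.unop] B i)).2 inferInstance
  · rintro _ _ ⟨i⟩
    exact ⟨_, (r i).op, (g i).op, ⟨i⟩, congrArg Quiver.Hom.op (h i).symm⟩

/-- Stability of the basic covers under base change makes them a coverage, so the sheaf condition
need only be checked on them. -/
instance fpqcTopology_subcanonical : (fpqcTopology k).Subcanonical := by
  let K : Coverage (CommAlgCat.{u} k)ᵒᵖ :=
    { __ := fpqcPrecoverage k
      pullback := fun _ _ f S hS => fpqcPrecoverage_pullback f S hS }
  have h : fpqcTopology k = K.toGrothendieck := K.toGrothendieck_toPrecoverage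
  rw [h]
  exact .of_isSheaf_yoneda_obj _ fun C => (Presieve.isSheaf_coverage K _).2 fun R hR =>
    isSheafFor_yoneda_of_mem_fpqcPrecoverage C _ hR

end Subcanonical

/-! ### The profinite reflection of a condensed set -/

section Reflection

/-- A point of a profinite set, as a morphism from the one-point space. -/
def pointHom {S : Profinite.{u}} (s : S) : Profinite.of PUnit.{u + 1} ⟶ S :=
  CompHausLike.ofHom _ (ContinuousMap.const _ s)

/-- The evaluation map `T → X(pt)` of a section `x ∈ X(T)`. -/
def Cond.evalPoint (X : Cond.{u}) {T : Profinite.{u}} (x : X.val T) (t : T) :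
    X.val (Profinite.of PUnit.{u + 1}) :=
  X.res (pointHom t) x

theorem Cond.evalPoint_res (X : Cond.{u}) {S T : Profinite.{u}} (g : S ⟶ T) (x : X.val T) (s : S) :
    X.evalPoint (X.res g x) s = X.evalPoint x (g s) := by
  have h := X.obj.obj.map_comp g.op (pointHom s).op
  exact congr($(h) x).symm

theorem Cond.app_evalPoint {X Y : Cond.{u}} (f : X ⟶ Y) {T : Profinite.{u}} (x : X.val T) (t : T) :
    Cond.app f _ (X.evalPoint x t) = Y.evalPoint (Cond.app f T x) t :=
  NatTrans.naturality_apply f.hom.hom (pointHom t).op x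

/-- The underlying topological space of a condensed set: `X(pt)` with the finest topology for which
all evaluation maps `T → X(pt)` are continuous. -/
def Cond.underlying (X : Cond.{u}) : TopCat.{u} :=
  @TopCat.of (X.val (Profinite.of PUnit.{u + 1}))
    (⨆ (T : Profinite.{u}) (x : X.val T), TopologicalSpace.coinduced (X.evalPoint x) inferInstance)

theorem Cond.continuous_evalPoint (X : Cond.{u}) {T : Profinite.{u}} (x : X.val T) :
    Continuous (Y := X.underlying) (X.evalPoint x) :=
  continuous_iff_coinduced_le.2 (le_iSup₂_of_le T x le_rfl)

theorem Cond.continuous_underlying_iff (X : Cond.{u}) {Z : Type*} [TopologicalSpace Z]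
    (f : X.underlying → Z) :
    Continuous f ↔ ∀ (T : Profinite.{u}) (x : X.val T), Continuous fun t => f (X.evalPoint x t) := by
  refine ⟨fun hf T x => hf.comp (X.continuous_evalPoint x), fun h => ?_⟩
  refine continuous_iSup_dom.2 fun T => continuous_iSup_dom.2 fun x => ?_
  exact continuous_coinduced_dom.2 (h T x)

/-- Morphisms from a condensed set to a profinite set are the continuous maps from its underlying
topological space. -/
def Cond.homEquivContinuousMap (X : Cond.{u}) (S : Profinite.{u}) :
    C(X.underlying, S) ≃ (X ⟶ profiniteToCond.obj S) where
  toFun f := ⟨⟨{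
    app := fun T => ↾fun x => CompHausLike.ofHom _
      ⟨fun t => f (X.evalPoint x t), f.continuous.comp (X.continuous_evalPoint x)⟩
    naturality := fun T T' g => by
      ext x
      refine ConcreteCategory.hom_ext (C := Profinite) _ _ fun t => ?_
      exact congrArg f (X.evalPoint_res g.unop x t) }⟩⟩
  invFun φ :=
    { toFun := fun y => (show Profinite.of PUnit.{u + 1} ⟶ S from Cond.app φ _ y) PUnit.unit
      continuous_toFun := by
        refine (X.continuous_underlying_iff _).2 fun T x => ?_
        have h : (fun t : T => (show Profinite.of PUnit.{u + 1} ⟶ S from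
            Cond.app φ _ (X.evalPoint x t)) PUnit.unit) =
            fun t => (show T ⟶ S from Cond.app φ T x) t := by
          funext t
          exact congrArg (fun g : Profinite.of PUnit.{u + 1} ⟶ S => g PUnit.unit) (Cond.app_evalPoint φ x t)
        rw [h]
        exact (show T ⟶ S from Cond.app φ T x).hom.hom.continuous }
  left_inv f := by
    ext y
    refine congrArg f ?_
    -- The only point of the one-point space is its identity map.
    have h := X.obj.obj.map_id (op (Profinite.of PUnit.{u + 1}))
    exact congr($(h) y)
  right_inv φ := by
    ext T x
    refine ConcreteCategory.hom_ext (C := Profinite) _ _ fun t => ?_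
    exact congrArg (fun g : Profinite.of PUnit.{u + 1} ⟶ S => g PUnit.unit) (Cond.app_evalPoint φ x t)

/-- The inclusion of profinite sets into condensed sets has a left adjoint: the profinite
reflection of the underlying topological space. -/
theorem isRightAdjoint_profiniteToCond : (profiniteToCond.{u}).IsRightAdjoint := by
  -- Stone–Čech compactification, then the profinite space of connected components; `e` chains the
  -- universal properties.
  let F (X : Cond.{u}) : Profinite.{u} := CompHaus.toProfiniteObj (stoneCechObj X.underlying)
  let e (X : Cond.{u}) (S : Profinite.{u}) : (F X ⟶ S) ≃ (X ⟶ profiniteToCond.obj S) :=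
    (((Profinite.toCompHausEquivalence _ S).trans
      (stoneCechEquivalence X.underlying (profiniteToCompHaus.obj S))).trans
      (ConcreteCategory.homEquiv (C := TopCat))).trans (X.homEquivContinuousMap S)
  exact (Adjunction.adjunctionOfEquivLeft e fun _ _ _ _ _ => rfl).isRightAdjoint

end Reflection

/-! ### The spectrum of the algebra of continuous functions -/

namespace LocallyConstant

variable {k : Type*} [Field k] {S : Type*} [TopologicalSpace S]

variable (k) in
/-- The prime ideal of the locally constant functions vanishing at a point. -/
def vanishingPrime (s : S) : PrimeSpectrum (LocallyConstant S k) :=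
  ⟨RingHom.ker (LocallyConstant.evalRingHom s : LocallyConstant S k →+* k), RingHom.ker_isPrime _⟩

@[simp]
theorem mem_vanishingPrime {s : S} {f : LocallyConstant S k} :
    f ∈ (vanishingPrime k s).asIdeal ↔ f s = 0 := Iff.rfl

/-- An ideal contains every function whose support lies in that of one of its elements. -/
theorem mem_of_support_subset {P : Ideal (LocallyConstant S k)}
    {f g : LocallyConstant S k} (hf : f ∈ P) (h : ∀ s, f s = 0 → g s = 0) : g ∈ P := by
  have : g = (g * f⁻¹) * f := by
    ext s
    by_cases hs : f s = 0
    · simp [hs, h s hs]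
    · simp [hs]
  rw [this]
  exact P.mul_mem_left _ hf

theorem one_sub_mul_inv_apply (f : LocallyConstant S k) (s : S) :
    (1 - f * f⁻¹) s = 1 - f s * (f s)⁻¹ := rfl

theorem exists_forall_apply_eq_zero [CompactSpace S] {P : Ideal (LocallyConstant S k)}
    (hP : P ≠ ⊤) : ∃ s : S, ∀ f ∈ P, f s = 0 := by
  by_contra! h
  obtain ⟨f, hf, hf'⟩ : ∃ f ∈ P, ∀ s ∈ Set.univ, f s ≠ 0 := by
    -- Compactness reduces the claim to neighbourhoods of points and finite unions.
    refine isCompact_univ.induction_on (p := fun U => ∃ f ∈ P, ∀ s ∈ U, f s ≠ 0)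
      ⟨0, P.zero_mem, by simp⟩ ?_ ?_ ?_
    · rintro U V hUV ⟨f, hf, hf'⟩
      exact ⟨f, hf, fun s hs => hf' s (hUV hs)⟩
    · rintro U V ⟨f, hf, hf'⟩ ⟨g, hg, hg'⟩
      -- Since `0⁻¹ = 0`, the factor `1 - f * f⁻¹` is the indicator of the zero set of `f`; the sum
      -- is `f` off that set and `g` on it.
      refine ⟨f + (1 - f * f⁻¹) * g, P.add_mem hf (P.mul_mem_left _ hg), fun s hs => ?_⟩
      by_cases hs' : f s = 0
      · simpa [one_sub_mul_inv_apply, hs'] using hg' s (hs.resolve_left fun h => hf' s h hs')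
      · simp [one_sub_mul_inv_apply, hs']
    · intro s _
      obtain ⟨f, hf, hfs⟩ := h s
      exact ⟨{t | f t = f s},
        mem_nhdsWithin_of_mem_nhds ((f.isLocallyConstant.isOpen_fiber _).mem_nhds rfl),
        f, hf, fun t ht => by rwa [show f t = f s from ht]⟩
  exact hP ((Ideal.eq_top_iff_one P).2
    (mem_of_support_subset hf fun s hs => absurd hs (hf' s trivial)))

variable [CompactSpace S] [T2Space S] [TotallyDisconnectedSpace S]

theorem vanishingPrime_bijective : Function.Bijective (vanishingPrime k : S → _) := by
  refine ⟨fun s t hst => ?_, fun P => ?_⟩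
  · by_contra hne
    obtain ⟨U, hU, hsU, htU⟩ := exists_isClopen_of_totally_separated hne
    have h : LocallyConstant.charFn k hU ∈ (vanishingPrime k s).asIdeal := by
      rw [hst, mem_vanishingPrime, LocallyConstant.charFn_eq_zero]
      exact htU
    rw [mem_vanishingPrime, LocallyConstant.charFn_eq_zero] at h
    exact h hsU
  · obtain ⟨s, hs⟩ := exists_forall_apply_eq_zero P.isPrime.ne_top
    refine ⟨s, PrimeSpectrum.ext (le_antisymm (fun f hf => ?_) hs)⟩
    rw [mem_vanishingPrime] at hf
    -- The indicator of the zero set of `f` kills `f`, and it is not in `P` because it takes the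
    -- value `1` at the common zero `s`.
    have h : (1 - f * f⁻¹) * f = 0 := by
      ext t
      by_cases ht : f t = 0 <;> simp [one_sub_mul_inv_apply, ht]
    refine (P.isPrime.mem_or_mem (h ▸ P.asIdeal.zero_mem)).resolve_left fun h' => ?_
    simpa [one_sub_mul_inv_apply, hf] using hs _ h'

variable (k S) in
/-- A profinite set is the spectrum of its algebra of continuous functions to a discrete field. -/
def homeomorphPrimeSpectrum : S ≃ₜ PrimeSpectrum (LocallyConstant S k) :=
  (Equiv.ofBijective _ vanishingPrime_bijective).toHomeomorphOfContinuousOpen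
    (PrimeSpectrum.isTopologicalBasis_basic_opens.continuous_iff.2 (by
      rintro _ ⟨f, rfl⟩
      exact f.isLocallyConstant {x | x ≠ 0}))
    -- The image of a clopen set is the basic open set of its characteristic function.
    ((isTopologicalBasis_isClopen (X := S)).isOpenMap_iff.2 fun U hU => by
      convert (PrimeSpectrum.basicOpen (LocallyConstant.charFn k hU)).isOpen
      ext P
      obtain ⟨s, rfl⟩ := vanishingPrime_bijective.surjective P
      have h1 : vanishingPrime k s ∈ vanishingPrime k '' U ↔ s ∈ U :=
        vanishingPrime_bijective.injective.mem_set_image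
      have h2 : LocallyConstant.charFn k hU s = 0 ↔ s ∉ U := LocallyConstant.charFn_eq_zero _ _ _
      exact h1.trans (not_iff_not.1 (by rw [← h2]; exact (not_not (a := _)).symm)))

end LocallyConstant

/-! ### The profinite reflection as the spectrum of `Hom(X, k)` -/

section CondSpectrum

variable {π₀ : Cond.{u} ⥤ Profinite.{u}} (adj : π₀ ⊣ profiniteToCond.{u})
  (k : Type u) [Field k] [Finite k]

/-- Continuous functions on the profinite reflection of a condensed set `X` are the morphisms from
`X` to the discrete condensed set. -/
def locallyConstantEquivCondHom (X : Cond.{u}) :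
    LocallyConstant (π₀.obj X) k ≃+* CondHom k X where
  __ := (homDiscreteEquiv k (π₀.obj X)).symm.trans (adj.homEquiv X (discreteProfinite k))
  map_mul' f g := by
    -- The adjunction bijection is precomposition with the unit, which respects pointwise
    -- operations.
    apply (condHomEquiv k X).injective
    simp only [Equiv.toFun_as_coe, Equiv.trans_apply, adj.homEquiv_unit]
    rfl
  map_add' f g := by
    apply (condHomEquiv k X).injective
    simp only [Equiv.toFun_as_coe, Equiv.trans_apply, adj.homEquiv_unit]
    rfl

/-- The profinite reflection of `X` is the spectrum of the ring of morphisms from `X` to a finite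
field. -/
def homeomorphSpecCondHom (X : Cond.{u}) : π₀.obj X ≃ₜ PrimeSpectrum (CondHom k X) :=
  (LocallyConstant.homeomorphPrimeSpectrum k (π₀.obj X)).trans
    (PrimeSpectrum.homeomorphOfRingEquiv (locallyConstantEquivCondHom adj k X))

theorem mem_homeomorphSpecCondHom (X : Cond.{u}) (p : π₀.obj X) (φ : CondHom k X) :
    φ ∈ (homeomorphSpecCondHom adj k X p).asIdeal ↔
      discreteProfiniteEquiv k ((adj.homEquiv X (discreteProfinite k)).symm φ p) = 0 :=
  Iff.rfl

/-- Both primes are described by vanishing at a point, so this is naturality of the adjunction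
bijection in `X`. -/
theorem homeomorphSpecCondHom_naturality {X Y : Cond.{u}} (f : X ⟶ Y) (p : π₀.obj X) :
    homeomorphSpecCondHom adj k Y (π₀.map f p) =
      PrimeSpectrum.comap (CondHom.pullback k f) (homeomorphSpecCondHom adj k X p) := by
  ext φ
  rw [PrimeSpectrum.comap_asIdeal, Ideal.mem_comap, mem_homeomorphSpecCondHom,
    mem_homeomorphSpecCondHom]
  have h := adj.homEquiv_naturality_left_symm f φ
  change _ ↔ discreteProfiniteEquiv k ((adj.homEquiv X (discreteProfinite k)).symm (f ≫ φ) p) = 0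
  rw [h]
  rfl

end CondSpectrum

/-! ### Global functions on pétra spaces -/

section GlobalFunctions

variable (k : Type u) [Field k]

/-- The affine line `A ↦ A`. -/
def affineLinePresheaf : (CommAlgCat.{u} k)ᵒᵖᵒᵖ ⥤ Type u :=
  unopUnop _ ⋙ forget (CommAlgCat.{u} k)

/-- The affine line is represented by the polynomial ring in one variable. -/
def affineLineRepresentableBy :
    (affineLinePresheaf k).RepresentableBy (op (CommAlgCat.of k (Polynomial k))) where
  homEquiv {A} :=
    { toFun := fun f => f.unop.hom Polynomial.X
      invFun := fun a => (CommAlgCat.ofHom (Polynomial.aeval (R := k) (A := A.unop) a)).op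
      left_inv := fun f => Quiver.Hom.unop_inj (by ext; simp)
      right_inv := fun a => Polynomial.aeval_X (R := k) (A := A.unop) a }
  homEquiv_comp _ _ := rfl

/-- The affine line as an fpqc sheaf. -/
def affineLine : FpqcSheaf k where
  obj := affineLinePresheaf k ⋙ uliftFunctor.{u + 1}
  property := by
    rw [isSheaf_iff_isSheaf_of_type]
    have := (affineLineRepresentableBy k).isRepresentable
    exact Presieve.isSheaf_comp_uliftFunctor _
      (GrothendieckTopology.Subcanonical.isSheaf_of_isRepresentable _)

variable {k} in
/-- Global functions are the morphisms to the affine line. -/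
def globalFunctionsEquiv (F : FpqcSheaf k) :
    globalFunctions k F.obj ≃ (F ⟶ affineLine k) where
  toFun a := ⟨{
    app := fun A => ↾fun x => ULift.up (a.1 A.unop.unop x)
    naturality := fun A B f => by
      ext x
      exact congrArg ULift.up (a.2 _ _ f.unop.unop x) }⟩
  invFun φ := ⟨fun A x => (φ.hom.app (op (op A)) x).down, fun A B f x =>
    congrArg ULift.down (NatTrans.naturality_apply φ.hom f.op.op x)⟩
  left_inv _ := rfl
  right_inv _ := rfl

theorem petraHomEquiv_naturality_left {X Y : Cond.{u}} (f : X ⟶ Y)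
    {Z : FpqcSheaf k} (g : (petra k).obj Y ⟶ Z) :
    petraHomEquiv k X Z ((petra k).map f ≫ g) =
      condToPresheaf.map f ≫ petraHomEquiv k Y Z g :=
  (congrArg (((continuousFunctions k).op.lanAdjunction (Type (u + 1))).homEquiv _ _)
    ((sheafificationAdjunction (fpqcTopology k) (Type (u + 1))).homEquiv_naturality_left
      ((continuousFunctions k).op.lan.map (condToPresheaf.map f)) g)).trans
    (((continuousFunctions k).op.lanAdjunction (Type (u + 1))).homEquiv_naturality_left _ _)

theorem petraHomEquiv_naturality_right {X : Cond.{u}}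
    {Y Z : FpqcSheaf k} (g : (petra k).obj X ⟶ Y) (h : Y ⟶ Z) :
    petraHomEquiv k X Z (g ≫ h) =
      petraHomEquiv k X Y g ≫ Functor.whiskerLeft (continuousFunctions k).op h.hom :=
  (congrArg (((continuousFunctions k).op.lanAdjunction (Type (u + 1))).homEquiv _ _)
    ((sheafificationAdjunction (fpqcTopology k) (Type (u + 1))).homEquiv_naturality_right
      g h)).trans
    (((continuousFunctions k).op.lanAdjunction (Type (u + 1))).homEquiv_naturality_right _ h.hom)

variable [Finite k]

variable {k} in
/-- The locally constant function attached to a section over `S` by a morphism to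
`S ↦ C(S, k)`. -/
def continuousFunctionOfSection {X : Cond.{u}}
    (φ : condToPresheaf.obj X ⟶ (continuousFunctions k).op ⋙ (affineLine k).obj)
    (S : Profinite.{u}) (x : X.val S) : LocallyConstant S k :=
  ULift.down.{u + 1} (φ.app (op S) (ULift.up.{u + 1} x : ULift.{u + 1} (X.val S)))

/-- Morphisms from a condensed set to `S ↦ C(S, k)` are the morphisms to the profinite set `k`. -/
def toContinuousFunctionsEquiv (X : Cond.{u}) :
    (condToPresheaf.obj X ⟶ (continuousFunctions k).op ⋙ (affineLine k).obj) ≃ CondHom k X where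
  toFun φ := ⟨⟨{
    app := fun S => ↾fun x =>
      (homDiscreteEquiv k S.unop).symm (continuousFunctionOfSection φ S.unop x)
    naturality := fun S T g => by
      ext x
      have h := NatTrans.naturality_apply φ g (ULift.up.{u + 1} x : ULift.{u + 1} (X.obj.obj.obj S))
      exact congrArg (fun y => (homDiscreteEquiv k T.unop).symm (ULift.down.{u + 1} y)) h }⟩⟩
  invFun φ :=
    { app := fun S => ↾fun x : ULift.{u + 1} (X.obj.obj.obj S) =>
        (ULift.up.{u + 1} (homDiscreteEquiv k S.unop (φ.hom.hom.app S x.down)) :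
          ULift.{u + 1} (LocallyConstant S.unop k))
      naturality := fun S T g => by
        ext x
        have h := NatTrans.naturality_apply φ.hom.hom g (ULift.down.{u + 1} x)
        exact congrArg (fun y => ULift.up.{u + 1} (homDiscreteEquiv k T.unop y)) h }
  left_inv _ := rfl
  right_inv _ := rfl

/-- Global functions on the pétra space of `X` are the morphisms from `X` to `k`. -/
def globalFunctionsPetraEquiv (X : Cond.{u}) :
    globalFunctions k ((petra k).obj X).obj ≃ CondHom k X :=
  (globalFunctionsEquiv _).trans
    ((petraHomEquiv k X (affineLine k)).trans (toContinuousFunctionsEquiv k X))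

theorem globalFunctionsPetraEquiv_pullback {X Y : Cond.{u}} (f : X ⟶ Y)
    (a : globalFunctions k ((petra k).obj Y).obj) :
    globalFunctionsPetraEquiv k X (globalFunctions.pullback ((petra k).map f).hom a) =
      CondHom.pullback k f (globalFunctionsPetraEquiv k Y a) := by
  have h := petraHomEquiv_naturality_left k f (globalFunctionsEquiv _ a)
  exact congrArg (toContinuousFunctionsEquiv k X) h

end GlobalFunctions

/-- The inclusion of profinite sets into condensed sets is fully faithful. -/
def profiniteToCondFullyFaithful : (profiniteToCond.{u}).FullyFaithful :=
  Functor.FullyFaithful.ofCompFaithful (G := ObjectProperty.ι _)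
    (coherentTopology Profinite.{u}).yonedaFullyFaithful

/-! ### Affinization of the unit map and of profinite pétra spaces -/

section Affinization

variable (k : Type u) [Field k]

theorem bijective_pullback_petra_unit [Finite k] {π₀ : Cond.{u} ⥤ Profinite.{u}}
    (adj : π₀ ⊣ profiniteToCond.{u}) (X : Cond.{u}) :
    Function.Bijective (globalFunctions.pullback ((petra k).map (adj.unit.app X)).hom) := by
  have h : Function.Bijective (CondHom.pullback k (adj.unit.app X)) := by
    -- As `k` is profinite, precomposition with the unit is full faithfulness followed by the
    -- adjunction bijection.
    have : ⇑(CondHom.pullback k (adj.unit.app X)) =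
        adj.homEquiv X (discreteProfinite k) ∘ profiniteToCondFullyFaithful.homEquiv.symm := by
      funext φ
      refine Eq.trans ?_ (adj.homEquiv_unit _ _ _).symm
      exact congrArg (adj.unit.app X ≫ ·) (profiniteToCondFullyFaithful.map_preimage φ).symm
    rw [this]
    exact (Equiv.bijective _).comp (Equiv.bijective _)
  have h' : globalFunctionsPetraEquiv k X ∘
      globalFunctions.pullback ((petra k).map (adj.unit.app X)).hom =
        CondHom.pullback k (adj.unit.app X) ∘ globalFunctionsPetraEquiv k _ :=
    funext fun a => globalFunctionsPetraEquiv_pullback k _ a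
  rw [← Function.Bijective.of_comp_iff' (globalFunctionsPetraEquiv k X).bijective, h']
  exact h.comp (Equiv.bijective _)

theorem isIso_affinizationPresheaf_map {F G : (CommAlgCat.{u} k)ᵒᵖᵒᵖ ⥤ Type (u + 1)} (η : F ⟶ G)
    (h : Function.Bijective (globalFunctions.pullback η)) :
    IsIso ((affinizationPresheaf k).map η) := by
  let e := AlgEquiv.ofBijective _ h
  have (A : (CommAlgCat.{u} k)ᵒᵖᵒᵖ) : IsIso (((affinizationPresheaf k).map η).app A) := by
    rw [isIso_iff_bijective]
    exact (e.symm.arrowCongr (AlgEquiv.refl (A₁ := A.unop.unop))).bijective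
  exact NatIso.isIso_of_isIso_app _

/-- Elements of `R` as global functions on `Spec R`. -/
def representableFunctions (R : CommAlgCat.{u} k) :
    R →ₐ[k] globalFunctions k ((fpqcTopology k).uliftYoneda.{u + 1}.obj (op R)).obj where
  toFun r := ⟨fun _ x => x.down.unop.hom r, fun _ _ _ _ => rfl⟩
  map_one' := Subtype.ext (by funext A x; exact map_one x.down.unop.hom)
  map_mul' r s := Subtype.ext (by funext A x; exact map_mul x.down.unop.hom r s)
  map_zero' := Subtype.ext (by funext A x; exact map_zero x.down.unop.hom)
  map_add' r s := Subtype.ext (by funext A x; exact map_add x.down.unop.hom r s)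
  commutes' r := Subtype.ext (by funext A x; exact x.down.unop.hom.commutes r)

/-- Yoneda: a global function is determined by its value at the identity point of `Spec R`. -/
theorem representableFunctions_surjective (R : CommAlgCat.{u} k) :
    Function.Surjective (representableFunctions k R) := fun a =>
  ⟨a.1 R (ULift.up (𝟙 _)), Subtype.ext (by
    funext A x
    have h := a.2 R A x.down.unop (ULift.up (𝟙 _))
    refine h.symm.trans (congrArg (a.1 A) (ULift.ext _ _ ?_))
    exact Category.comp_id x.down)⟩

/-- Affine schemes agree with their affinization. -/
theorem isIso_toAffinization_uliftYoneda (R : CommAlgCat.{u} k) :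
    IsIso ((toAffinization k).app ((fpqcTopology k).uliftYoneda.{u + 1}.obj (op R))) := by
  have (A : (CommAlgCat.{u} k)ᵒᵖᵒᵖ) : IsIso (((toAffinization k).app
      ((fpqcTopology k).uliftYoneda.{u + 1}.obj (op R))).app A) := by
    rw [isIso_iff_bijective]
    refine ⟨fun x y hxy => ULift.ext _ _ (Quiver.Hom.unop_inj ?_), fun φ => ?_⟩
    · ext r
      exact congrArg (fun φ : globalFunctions k
        ((fpqcTopology k).uliftYoneda.{u + 1}.obj (op R)).obj →ₐ[k] A.unop.unop =>
          φ (representableFunctions k R r)) hxy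
    -- The point of `Spec R` is the restriction of `φ` to functions coming from `R`, which are all
    -- of them.
    · refine ⟨ULift.up (CommAlgCat.ofHom (φ.comp (representableFunctions k R))).op, ?_⟩
      refine AlgHom.ext fun a => ?_
      obtain ⟨r, rfl⟩ := representableFunctions_surjective k R a
      rfl
  exact NatIso.isIso_of_isIso_app _

/-- The pétra space of a profinite set `S` corepresents `𝒴 ↦ 𝒴(C(S, k))`. -/
def petraProfiniteCorepresentableBy (S : Profinite.{u}) :
    (sheafToPresheaf (fpqcTopology k) (Type (u + 1)) ⋙
      (evaluation _ _).obj (op ((continuousFunctions k).obj S))).CorepresentableBy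
        ((petra k).obj (profiniteToCond.obj S)) where
  homEquiv {Y} := (petraHomEquiv k _ Y).trans
    (uliftYonedaEquiv (F := (continuousFunctions k).op ⋙ Y.obj))
  homEquiv_comp g f := congrArg
    (uliftYonedaEquiv.{u + 1} (X := S)) (petraHomEquiv_naturality_right k f g)

/-- A representable sheaf `Spec R` corepresents `𝒴 ↦ 𝒴(R)`. -/
def uliftYonedaCorepresentableBy (R : (CommAlgCat.{u} k)ᵒᵖ) :
    (sheafToPresheaf (fpqcTopology k) (Type (u + 1)) ⋙
      (evaluation _ _).obj (op R)).CorepresentableBy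
        ((fpqcTopology k).uliftYoneda.{u + 1}.obj R) where
  homEquiv {Y} := (fullyFaithfulSheafToPresheaf _ _).homEquiv.trans
    (uliftYonedaEquiv (F := Y.obj))
  homEquiv_comp _ _ := rfl

/-- The pétra space of a profinite set agrees with its affinization. -/
theorem isIso_toAffinization_petra_profinite (S : Profinite.{u}) :
    IsIso ((toAffinization k).app ((petra k).obj (profiniteToCond.obj S))) := by
  -- Both sheaves corepresent `𝒴 ↦ 𝒴(C(S, k))`, so the claim transfers from `Spec C(S, k)`.
  let e := (petraProfiniteCorepresentableBy k S).uniqueUpToIso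
    (uliftYonedaCorepresentableBy k ((continuousFunctions k).obj S))
  rw [NatTrans.isIso_app_iff_of_iso _ e]
  exact isIso_toAffinization_uliftYoneda k _

end Affinization

/-! ### The natural comparison isomorphism -/

section Comparison

variable (k : Type u) [Field k] [Finite k] {π₀ : Cond.{u} ⥤ Profinite.{u}}
  (adj : π₀ ⊣ profiniteToCond.{u})

/-- The affinization of the pétra space of `X` agrees with that of its profinite reflection. -/
def affinizationPetraIso :
    petra k ⋙ affinization k ≅ (π₀ ⋙ profiniteToCond) ⋙ petra k ⋙ affinization k :=
  NatIso.ofComponents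
    (fun X =>
      @asIso _ _ _ _ ((affinizationPresheaf k).map ((petra k).map (adj.unit.app X)).hom)
        (isIso_affinizationPresheaf_map k _ (bijective_pullback_petra_unit k adj X)))
    fun f => (Functor.whiskerRight adj.unit (petra k ⋙ affinization k)).naturality f

/-- Pétra spaces of profinite sets agree with their affinization. -/
def petraProfiniteIso (π₀ : Cond.{u} ⥤ Profinite.{u}) :
    (π₀ ⋙ profiniteToCond) ⋙ petra k ⋙ sheafToPresheaf _ _ ≅
      (π₀ ⋙ profiniteToCond) ⋙ petra k ⋙ affinization k :=
  NatIso.ofComponents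
    (fun X =>
      haveI := isIso_toAffinization_petra_profinite k (π₀.obj X)
      asIso ((toAffinization k).app ((petra k).obj (profiniteToCond.obj (π₀.obj X)))))
    fun f => (Functor.whiskerLeft ((π₀ ⋙ profiniteToCond) ⋙ petra k) (toAffinization k)).naturality f

/-- This is the naturality square of `toAffinization` at the pétra map of the unit, with the
invertible side for the profinite reflection moved across. -/
theorem toAffinization_comp_iso (X : Cond.{u}) :
    (toAffinization k).app ((petra k).obj X) ≫
        (affinizationPetraIso k adj ≪≫ (petraProfiniteIso k π₀).symm).hom.app X =
      ((petra k).map (adj.unit.app X)).hom := by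
  have h := (toAffinization k).naturality ((petra k).map (adj.unit.app X))
  have := isIso_toAffinization_petra_profinite k (π₀.obj X)
  refine (Category.assoc _ _ _).symm.trans ?_
  exact (IsIso.comp_inv_eq _).2 h.symm

end Comparison

end Petra

end

theorem mainTheorem12 :
    (profiniteToCond.{u}).IsRightAdjoint ∧
    ∀ (π₀ : Cond.{u} ⥤ Profinite.{u}) (adj : π₀ ⊣ profiniteToCond.{u})
      (k : Type u) [Field k] [Finite k],
      (∃ h : ∀ X : Cond.{u}, π₀.obj X ≃ₜ PrimeSpectrum (CondHom k X),
        (∀ (X : Cond.{u}) (p : π₀.obj X) (φ : CondHom k X),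
          φ ∈ (h X p).asIdeal ↔
            discreteProfiniteEquiv k ((adj.homEquiv X (discreteProfinite k)).symm φ p) = 0) ∧
        (∀ (X Y : Cond.{u}) (f : X ⟶ Y) (p : π₀.obj X),
          h Y (π₀.map f p) = PrimeSpectrum.comap (CondHom.pullback k f) (h X p))) ∧
      ∃ e : petra k ⋙ affinization k ≅
          (π₀ ⋙ profiniteToCond) ⋙ petra k ⋙ sheafToPresheaf _ _,
        ∀ X : Cond.{u},
          (toAffinization k).app ((petra k).obj X) ≫ e.hom.app X =
            ((petra k).map (adj.unit.app X)).hom := by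
  refine ⟨isRightAdjoint_profiniteToCond, fun π₀ adj k _ _ => ⟨⟨homeomorphSpecCondHom adj k,
    mem_homeomorphSpecCondHom adj k, fun X Y f p => homeomorphSpecCondHom_naturality adj k f p⟩,
    affinizationPetraIso k adj ≪≫ (petraProfiniteIso k π₀).symm,
    toAffinization_comp_iso k adj⟩⟩
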